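/- A partial word over an alphabet $\mathcal A$ is a finite sequence over $\mathcal A\cup\{\diamond\}$, where $\diamond$ (the hole) is not a letter; its hole density is its number of holes divided by its length. Two partial words are compatible if they have the same length and agree at every position where both have a letter. A partial word $w$ over $\mathcal A$ encounters a pattern $p\in\mathcal V^*$ if some factor (block of consecutive characters) of $w$ is compatible with $h(p)$ for some nonerasing morphism $h:\mathcal V^*\to\mathcal A^*$. The Zimin patterns are $Z_1=a_1$ and $Z_i=Z_{i-1}a_iZ_{i-1}$ for $i\ge 2$, where $a_1,a_2,\dots$ are distinct variables. For an integer $m\ge1$ and $d\in\mathbb Q\cap(0,1)$, the partial Ramsey length $L_d(m,p)$ is the least $n\ge1$ such that partial words of length $n$ with hole density $d$ over an $m$-letter alphabet exist and every one of them encounters $p$. Corollary. For all integers $m,i\ge1$ and all $d\in\mathbb Q\cap(0,1)$, $$L_d(m,Z_i)\ \ge\ (1+o(1))\sqrt{2\prod_{j=1}^{i-1}\left(\frac{m^{2^j-1}}{[1+d(m-1)]^{2^j}-\left(1-\frac1m\right)(md)^{2^j}}-1\right)},$$ where $o(1)$ denotes a real quantity depending on $m$, $i$, $d$ that tends to $0$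 as $\max(m,i)\to\infty$, uniformly in $d$. -/

import Mathlib

/-- A partial word over `A`: a finite sequence over `A` extended by the hole character `none`. -/
abbrev PartialWord (A : Type*) := List (Option A)

namespace PartialWord

/-- The number of holes of a partial word divided by its length. -/
def holeDensity {A : Type*} (w : PartialWord A) : ℚ :=
  (w.countP Option.isNone : ℚ) / (w.length : ℚ)

/-- `u ↑ v`: the words have equal length and agree wherever both carry letters. -/
def Compatible {A : Type*} (u v : PartialWord A) : Prop :=
  List.Forall₂ (fun x y => ∀ a b : A, x = some a → y = some b → a = b) u v

/-- The full word `v`, seen as a partial word without holes. -/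
def ofWord {A : Type*} (v : List A) : PartialWord A := v.map some

/-- `w` encounters the pattern `p`: some factor of `w` is compatible with `h(p)` for a nonerasing
morphism `h`. The morphism is given by its nonempty values on letters; its value on `p` is the
concatenation of the values on the letters of `p`. -/
def Encounters {V A : Type*} (w : PartialWord A) (p : List V) : Prop :=
  ∃ h : V → List A, (∀ x, h x ≠ []) ∧
    ∃ f : PartialWord A, f <:+: w ∧ Compatible f (ofWord (p.flatMap h))

end PartialWord

/-- The Zimin patterns `Z₁ = a₁`, `Zᵢ₊₁ = Zᵢ aᵢ₊₁ Zᵢ`, with the natural number `i` as the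
variable `aᵢ` (and `Z₀` empty). -/
def zimin : ℕ → List ℕ
  | 0 => []
  | i + 1 => zimin i ++ [i + 1] ++ zimin i

/-- The partial Ramsey length `L_d(m, p)`: the least length `n ≥ 1` for which partial words of
length `n` and hole density `d` over an `m`-letter alphabet exist and all of them encounter `p`. -/
noncomputable def partialRamseyLength {V : Type*} (d : ℚ) (m : ℕ) (p : List V) : ℕ :=
  sInf {n : ℕ | 0 < n ∧
    (∃ w : PartialWord (Fin m), w.length = n ∧ w.holeDensity = d) ∧
    ∀ w : PartialWord (Fin m), w.length = n → w.holeDensity = d → w.Encounters p}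

/-! The proof is a first moment argument over pairs of a hole set `H` with `h = d n` elements and a
full word `v` of length `n`; it gives the bound with o(1) = 0. If every punched word meets Z_{e+1},
then each pair admits lengths of the variable images and an offset such that all positions with the
same label (a variable and an index inside its image) carry at most one letter. The variable a_{j+1}
with j < e occurs 2^(e-j) times; the last variable occurs once and imposes nothing.

With independent holes, a fixed placement would have probability ∏ P_j^(l_j), where P_j = `agreeProb
m (2 ^ (e - j)) d`, since the blocks of equal labels are disjoint. For exactly `h` holes, two facts
replace independence: block weights are negatively correlated (`sum_powersetCard_prod_le`), and a
single block of size k costs at most a factor (n/(n-1))^(k-1) (`sum_block_weight_le`). If s is the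
length contributed by the first e variables, Bernoulli's inequality bounds the total loss by
n/(n-s+1), while there are at most (n-s)(n-s+1)/2 choices of offset and last length; together at
most n²/2. Summing geometric series over the lengths gives 1 ≤ (n²/2) ∏ (1/P_j - 1)⁻¹, which is the
claim after `denominator_eq_agreeProb`.

Unavoidability of Zimin patterns is needed as well, so that the infimum defining the Ramsey length
is attained. -/

open Finset in
/-- Abel summation: nonnegative partial sums against a nonnegative antitone weight. -/
theorem sum_mul_nonneg_of_partialSums_nonneg (b w : ℕ → ℝ) (k : ℕ)
    (hb : ∀ r ≤ k, 0 ≤ ∑ j ∈ range (r + 1), b j) (hw : ∀ r < k, w (r + 1) ≤ w r)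
    (hk : 0 ≤ w k) : 0 ≤ ∑ r ∈ range (k + 1), b r * w r := by
  have key : ∀ l ≤ k, w l * ∑ j ∈ range (l + 1), b j ≤ ∑ r ∈ range (l + 1), b r * w r := by
    intro l
    induction l with
    | zero => intro _; simp [mul_comm]
    | succ l ih =>
      intro hl
      rw [sum_range_succ _ (l + 1), sum_range_succ (fun r => b r * w r) (l + 1)]
      have h1 := ih (by omega)
      have h2 := mul_le_mul_of_nonneg_right (hw l (by omega)) (hb l (by omega))
      linarith
  exact (mul_nonneg hk (hb k le_rfl)).trans (key k le_rfl)

open Finset in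
/-- Weighted Chebyshev sum inequality for oppositely ordered sequences. -/
theorem sum_mul_sum_le_of_antivary {ι : Type*} (s : Finset ι) (p f g : ι → ℝ)
    (h : ∀ a ∈ s, ∀ b ∈ s, p a * p b * ((f a - f b) * (g a - g b)) ≤ 0) :
    (∑ a ∈ s, p a * (f a * g a)) * ∑ a ∈ s, p a
      ≤ (∑ a ∈ s, p a * f a) * ∑ a ∈ s, p a * g a := by
  -- Summed over all ordered pairs, the hypothesis becomes twice the difference of the two sides.
  have h0 : ∑ a ∈ s, ∑ b ∈ s, p a * p b * ((f a - f b) * (g a - g b)) ≤ 0 :=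
    sum_nonpos fun a ha => sum_nonpos fun b hb => h a ha b hb
  have e : ∑ a ∈ s, ∑ b ∈ s, p a * p b * ((f a - f b) * (g a - g b))
      = 2 * ((∑ a ∈ s, p a * (f a * g a)) * ∑ a ∈ s, p a
        - (∑ a ∈ s, p a * f a) * ∑ a ∈ s, p a * g a) := by
    have e1 : ∑ a ∈ s, ∑ b ∈ s, p a * p b * ((f a - f b) * (g a - g b))
        = ∑ a ∈ s, ∑ b ∈ s, (p a * (f a * g a)) * p b
          + ∑ a ∈ s, ∑ b ∈ s, p a * (p b * (f b * g b))
          - ∑ a ∈ s, ∑ b ∈ s, (p a * f a) * (p b * g b)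
          - ∑ a ∈ s, ∑ b ∈ s, (p a * g a) * (p b * f b) := by
      simp only [← sum_add_distrib, ← sum_sub_distrib]
      exact sum_congr rfl fun a _ => sum_congr rfl fun b _ => by ring
    rw [e1]
    simp only [← sum_mul_sum]
    ring
  linarith

/-! ### Negative association for a uniformly random `h`-subset. -/

section Hypergeometric

open Finset

variable {α : Type*} [DecidableEq α]

/-- Double counting: a set with a marked element is the same as a smaller set with a marked element
outside it. -/
theorem sum_powersetCard_erase (B : Finset α) (j : ℕ) (F : Finset α → ℝ) :
    ∑ T ∈ powersetCard (j + 1) B, ∑ t ∈ T, F (T.erase t)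
      = ∑ R ∈ powersetCard j B, ((#B - j : ℕ) : ℝ) * F R := by
  have e : ∀ R ∈ powersetCard j B, ((#B - j : ℕ) : ℝ) * F R = ∑ _t ∈ B \ R, F R := by
    intro R hR
    rw [mem_powersetCard] at hR
    rw [sum_const, nsmul_eq_mul, card_sdiff_of_subset hR.1, hR.2]
  rw [sum_congr rfl e, sum_sigma', sum_sigma']
  refine sum_bij' (fun x _ => ⟨x.1.erase x.2, x.2⟩) (fun x _ => ⟨insert x.2 x.1, x.2⟩)
    ?_ ?_ ?_ ?_ ?_
  · rintro ⟨T, t⟩ h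
    simp only [mem_sigma, mem_powersetCard, mem_sdiff] at h ⊢
    refine ⟨⟨(erase_subset _ _).trans h.1.1, ?_⟩, h.1.1 h.2, notMem_erase _ _⟩
    rw [card_erase_of_mem h.2, h.1.2]; rfl
  · rintro ⟨R, t⟩ h
    simp only [mem_sigma, mem_powersetCard, mem_sdiff] at h ⊢
    refine ⟨⟨insert_subset h.2.1 h.1.1, ?_⟩, mem_insert_self _ _⟩
    rw [card_insert_of_notMem h.2.2, h.1.2]
  · rintro ⟨T, t⟩ h
    simp only [mem_sigma, mem_powersetCard] at h
    simp [insert_erase h.2]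
  · rintro ⟨R, t⟩ h
    simp only [mem_sigma, mem_powersetCard, mem_sdiff] at h
    simp [erase_insert h.2.2]
  · intros; rfl

/-- The average of a monotone set function over `j`-subsets increases with `j`. -/
theorem average_powersetCard_mono (B : Finset α) (F : Finset α → ℝ) (hF : Monotone F)
    {j j' : ℕ} (hj : j ≤ j') (hB : j' ≤ #B) :
    (∑ S ∈ powersetCard j B, F S) / ((#B).choose j : ℝ)
      ≤ (∑ S ∈ powersetCard j' B, F S) / ((#B).choose j' : ℝ) := by
  induction j', hj using Nat.le_induction with
  | base => exact le_rfl
  | succ l _ ih =>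
    refine (ih (by omega)).trans ?_
    have h1 : ((#B - l : ℕ) : ℝ) * ∑ S ∈ powersetCard l B, F S
        ≤ ((l + 1 : ℕ) : ℝ) * ∑ S ∈ powersetCard (l + 1) B, F S := by
      rw [mul_sum, ← sum_powersetCard_erase, mul_sum]
      refine sum_le_sum fun T hT => ?_
      rw [← (mem_powersetCard.1 hT).2, ← nsmul_eq_mul]
      exact sum_le_card_nsmul _ _ _ fun t _ => hF (erase_subset _ _)
    have h2 : ((#B).choose (l + 1) : ℝ) * ((l + 1 : ℕ) : ℝ)
        = ((#B).choose l : ℝ) * ((#B - l : ℕ) : ℝ) := by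
      exact_mod_cast Nat.choose_succ_right_eq (#B) l
    have p1 : (0 : ℝ) < (#B).choose l := by exact_mod_cast Nat.choose_pos (by omega)
    have p2 : (0 : ℝ) < (#B).choose (l + 1) := by exact_mod_cast Nat.choose_pos hB
    have p3 : (0 : ℝ) < ((l + 1 : ℕ) : ℝ) := by positivity
    rw [div_le_div_iff₀ p1 p2]
    refine le_of_mul_le_mul_right ?_ p3
    calc (∑ S ∈ powersetCard l B, F S) * ((#B).choose (l + 1) : ℝ) * ((l + 1 : ℕ) : ℝ)
        = ((#B).choose l : ℝ) * (((#B - l : ℕ) : ℝ) * ∑ S ∈ powersetCard l B, F S) := by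
          rw [mul_assoc, h2]; ring
      _ ≤ ((#B).choose l : ℝ) * (((l + 1 : ℕ) : ℝ) * ∑ S ∈ powersetCard (l + 1) B, F S) :=
          mul_le_mul_of_nonneg_left h1 p1.le
      _ = _ := by ring

variable [Fintype α]

/-- Conditions on a = #(H ∩ G): the parts of `H` inside and outside `G` are then chosen freely, and
`F` sees only the outer one. -/
theorem sum_powersetCard_split (G : Finset α) (h : ℕ) (φ : ℕ → ℝ) (F : Finset α → ℝ)
    (hF : ∀ H, F (H \ G) = F H) :
    ∑ H ∈ powersetCard h univ, φ #(H ∩ G) * F H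
      = ∑ a ∈ range (h + 1),
          φ a * (((#G).choose a : ℝ) * ∑ S ∈ powersetCard (h - a) Gᶜ, F S) := by
  have e : ∀ a ∈ range (h + 1), φ a * (((#G).choose a : ℝ) * ∑ S ∈ powersetCard (h - a) Gᶜ, F S)
      = ∑ x ∈ powersetCard a G ×ˢ powersetCard (h - a) Gᶜ, φ a * F x.2 := by
    intro a _
    rw [sum_product]
    simp only [sum_const, card_powersetCard, nsmul_eq_mul, ← mul_sum]
    ring
  rw [sum_congr rfl e, sum_sigma']
  refine sum_bij' (fun H _ => ⟨#(H ∩ G), H ∩ G, H \ G⟩) (fun x _ => x.2.1 ∪ x.2.2) ?_ ?_ ?_ ?_ ?_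
  · intro H hH
    have hc := (mem_powersetCard.1 hH).2
    have := card_inter_add_card_sdiff H G
    simp only [mem_sigma, mem_range, mem_product, mem_powersetCard]
    refine ⟨by omega, ⟨inter_subset_right, trivial⟩, ?_, by omega⟩
    intro x hx
    simp only [mem_sdiff] at hx
    simpa using hx.2
  · rintro ⟨a, A, S⟩ hx
    simp only [mem_sigma, mem_range, mem_product, mem_powersetCard] at hx ⊢
    refine ⟨subset_univ _, ?_⟩
    rw [card_union_of_disjoint, hx.2.1.2, hx.2.2.2]
    · omega
    · exact disjoint_of_subset_left hx.2.1.1 (disjoint_of_subset_right hx.2.2.1 disjoint_compl_right)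
  · intro H _
    ext x; by_cases hx : x ∈ G <;> simp [hx]
  · rintro ⟨a, A, S⟩ hx
    simp only [mem_sigma, mem_range, mem_product, mem_powersetCard] at hx
    obtain ⟨-, ⟨hA, hAc⟩, hS, -⟩ := hx
    have h1 : (A ∪ S) ∩ G = A := by
      ext x
      have := @hA x; have := @hS x
      simp only [mem_compl] at this
      simp only [mem_inter, mem_union]; tauto
    have h2 : (A ∪ S) \ G = S := by
      ext x
      have := @hA x; have := @hS x
      simp only [mem_compl] at this
      simp only [mem_sdiff, mem_union]; tauto
    simp only [h1, h2, hAc]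
  · intro H _
    simp only [hF]

/-- Negative association of a uniformly random `h`-subset, for a function of the number of elements
in `G` and a function of the elements outside `G`, both increasing. -/
theorem sum_powersetCard_mul_le (G : Finset α) (h : ℕ) (φ : ℕ → ℝ) (hφ : Monotone φ)
    (F : Finset α → ℝ) (hFm : Monotone F) (hF : ∀ H, F (H \ G) = F H) :
    (∑ H ∈ powersetCard h univ, φ #(H ∩ G) * F H) * ((Fintype.card α).choose h : ℝ)
      ≤ (∑ H ∈ powersetCard h univ, φ #(H ∩ G)) * ∑ H ∈ powersetCard h univ, F H := by
  have s1 := sum_powersetCard_split G h φ F hF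
  have s2 := sum_powersetCard_split G h φ (fun _ => 1) (fun _ => rfl)
  have s3 := sum_powersetCard_split G h (fun _ => 1) F hF
  have s4 := sum_powersetCard_split G h (fun _ => 1) (fun _ => 1) (fun _ => rfl)
  simp only [one_mul, mul_one, sum_const, nsmul_eq_mul, card_powersetCard, card_univ]
    at s1 s2 s3 s4
  rw [s1, s2, s3, s4]
  -- `A a` is the conditional mean of `F` given #(H ∩ G) = a, and `p a` the unnormalised
  -- hypergeometric weight. More elements inside `G` leave fewer outside, so `A` decreases where `p`
  -- is nonzero while `φ` increases, and Chebyshev's inequality applies.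
  set A : ℕ → ℝ := fun a => (∑ S ∈ powersetCard (h - a) Gᶜ, F S) / ((#Gᶜ).choose (h - a) : ℝ)
    with hA
  set p : ℕ → ℝ := fun a => ((#G).choose a : ℝ) * ((#Gᶜ).choose (h - a) : ℝ) with hp
  have hS : ∀ a, ∑ S ∈ powersetCard (h - a) Gᶜ, F S = ((#Gᶜ).choose (h - a) : ℝ) * A a := by
    intro a
    by_cases h0 : (#Gᶜ).choose (h - a) = 0
    · have : powersetCard (h - a) Gᶜ = ∅ := by
        rw [← card_eq_zero, card_powersetCard, h0]
      simp [this, h0]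
    · have : ((#Gᶜ).choose (h - a) : ℝ) ≠ 0 := by exact_mod_cast h0
      rw [hA]; field_simp
  have key := sum_mul_sum_le_of_antivary (range (h + 1)) p φ A ?_
  · calc _ = (∑ a ∈ range (h + 1), p a * (φ a * A a)) * ∑ a ∈ range (h + 1), p a := by
          congr 1
          refine sum_congr rfl fun a _ => ?_
          rw [hS, hp]; ring
      _ ≤ _ := key
      _ = _ := by
          congr 1
          · refine sum_congr rfl fun a _ => ?_
            rw [hp]; ring
          · refine sum_congr rfl fun a _ => ?_
            rw [hS, hp]; ring
  · have main : ∀ a b, a ≤ b → p a * p b * ((φ a - φ b) * (A a - A b)) ≤ 0 := by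
      intro a b hab
      have hp0 : ∀ c, 0 ≤ p c := fun c => by positivity
      by_cases ha : (#Gᶜ).choose (h - a) = 0
      · have : p a = 0 := by simp [hp, ha]
        simp [this]
      · have h1 : h - a ≤ #Gᶜ := by
          by_contra hc
          exact ha (Nat.choose_eq_zero_of_lt (by omega))
        have h2 : A b ≤ A a := average_powersetCard_mono Gᶜ F hFm (by omega) h1
        have h3 := hφ hab
        exact mul_nonpos_of_nonneg_of_nonpos (mul_nonneg (hp0 a) (hp0 b))
          (mul_nonpos_of_nonpos_of_nonneg (by linarith) (by linarith))
    intro a _ b _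
    rcases le_total a b with hab | hab
    · exact main a b hab
    · have := main b a hab
      calc _ = p b * p a * ((φ b - φ a) * (A b - A a)) := by ring
        _ ≤ 0 := this

/-- Negative association for a product over pairwise disjoint blocks. -/
theorem sum_powersetCard_prod_le {ι : Type*} [DecidableEq ι] (s : Finset ι) (G : ι → Finset α)
    (hG : (s : Set ι).PairwiseDisjoint G) (h : ℕ) (hh : h ≤ Fintype.card α)
    (φ : ι → ℕ → ℝ) (hφ : ∀ i, Monotone (φ i)) (h0 : ∀ i a, 0 ≤ φ i a)
    (c : ι → ℝ) (hc : ∀ i ∈ s, ∑ H ∈ powersetCard h univ, φ i #(H ∩ G i)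
      ≤ ((Fintype.card α).choose h : ℝ) * c i) :
    ∑ H ∈ powersetCard h univ, ∏ i ∈ s, φ i #(H ∩ G i)
      ≤ ((Fintype.card α).choose h : ℝ) * ∏ i ∈ s, c i := by
  have hpos : (0 : ℝ) < (Fintype.card α).choose h := by exact_mod_cast Nat.choose_pos hh
  induction s using Finset.induction_on with
  | empty => simp
  | insert i s hi ih =>
    simp only [prod_insert hi]
    have ih' := ih (hG.subset (by simp)) (fun j hj => hc j (mem_insert_of_mem hj))
    have key := sum_powersetCard_mul_le (G i) h (φ i) (hφ i)
      (fun H => ∏ j ∈ s, φ j #(H ∩ G j)) ?_ ?_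
    · refine le_of_mul_le_mul_right (key.trans ?_) hpos
      have hi' := hc i (mem_insert_self _ _)
      calc _ ≤ (((Fintype.card α).choose h : ℝ) * c i)
            * (((Fintype.card α).choose h : ℝ) * ∏ i ∈ s, c i) :=
            mul_le_mul hi' ih' (sum_nonneg fun H _ => prod_nonneg fun j _ => h0 _ _)
              ((sum_nonneg fun H _ => h0 _ _).trans hi')
        _ = _ := by ring
    · intro H H' hHH
      exact prod_le_prod (fun j _ => h0 _ _) fun j _ =>
        hφ j (card_le_card (inter_subset_inter_right hHH))
    · intro H
      refine prod_congr rfl fun j hj => ?_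
      have hd : Disjoint (G i) (G j) := hG (by simp) (by simp [hj]) (by rintro rfl; exact hi hj)
      congr 2
      ext x
      simp only [mem_inter, mem_sdiff]
      have := @disjoint_left _ (G i) (G j)
      constructor
      · tauto
      · intro hx
        exact ⟨⟨hx.1, fun hxi => this.1 hd hxi hx.2⟩, hx.2⟩

/-- Removing `S` leaves an (h - #S)-subset of its complement; the rest is the identity C(n,h) C(h,s)
= C(n,s) C(n-s,h-s). -/
theorem card_filter_subset_powersetCard (S : Finset α) (h : ℕ) :
    (#{H ∈ powersetCard h univ | S ⊆ H}) * (Fintype.card α).choose #S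
      = (Fintype.card α).choose h * h.choose #S := by
  by_cases hS : #S ≤ h
  · have e : #{H ∈ powersetCard h univ | S ⊆ H} = #(powersetCard (h - #S) Sᶜ) := by
      refine card_bij' (fun H _ => H \ S) (fun T _ => T ∪ S) ?_ ?_ ?_ ?_
      · intro H hH
        simp only [mem_filter, mem_powersetCard] at hH ⊢
        refine ⟨fun x hx => by simpa using (mem_sdiff.1 hx).2, ?_⟩
        rw [card_sdiff_of_subset hH.2, hH.1.2]
      · intro T hT
        simp only [mem_filter, mem_powersetCard] at hT ⊢
        refine ⟨⟨subset_univ _, ?_⟩, subset_union_right⟩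
        rw [card_union_of_disjoint (disjoint_of_subset_left hT.1 disjoint_compl_left), hT.2]
        omega
      · intro H hH
        simp only [mem_filter] at hH
        exact sdiff_union_of_subset hH.2
      · intro T hT
        simp only [mem_powersetCard] at hT
        exact union_sdiff_cancel_right (disjoint_of_subset_left hT.1 disjoint_compl_left)
    rw [e, card_powersetCard, card_compl, mul_comm]
    by_cases hh : h ≤ Fintype.card α
    · rw [← Nat.choose_mul (n := Fintype.card α) hS]
    · rw [Nat.choose_eq_zero_of_lt (n := Fintype.card α) (k := h) (by omega),
        Nat.choose_eq_zero_of_lt (n := Fintype.card α - #S) (k := h - #S)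
          (by have := card_le_univ S; omega)]
      simp
  · rw [Nat.choose_eq_zero_of_lt (n := h) (k := #S) (by omega)]
    have : ({H ∈ powersetCard h univ | S ⊆ H} : Finset (Finset α)) = ∅ := by
      refine filter_eq_empty_iff.2 fun H hH hSH => ?_
      have := card_le_card hSH
      rw [(mem_powersetCard.1 hH).2] at this
      exact hS this
    simp [this]

end Hypergeometric

/-! ### One block: a fixed number of holes against independent holes. -/

/-- The probability that `k` independent characters, each a hole with probability `d` and otherwise
a uniformly random one of `m` letters, carry at most one letter. -/
noncomputable def agreeProb (m k : ℕ) (d : ℝ) : ℝ :=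
  m * (d + (1 - d) / m) ^ k - (m - 1) * d ^ k

-- Expanding in powers of `d` permits a termwise comparison: d^r is the probability that r given
-- positions are independent holes, and C(h,r)/C(n,r) is its analogue for exactly `h` holes.
open Finset in
theorem agreeProb_eq_sum (m k : ℕ) (d : ℝ) :
    agreeProb m k d = ∑ r ∈ range (k + 1),
      ((k.choose r : ℝ) * (m * ((1 - 1 / (m : ℝ)) ^ r * (1 / (m : ℝ)) ^ (k - r)))
        - if r = k then (m : ℝ) - 1 else 0) * d ^ r := by
  have : d + (1 - d) / m = (1 - 1 / (m : ℝ)) * d + 1 / m := by ring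
  simp only [agreeProb, this, add_pow, mul_pow]
  simp only [sub_mul, sum_sub_distrib, ite_mul, zero_mul, sum_ite_eq', mem_range,
    Nat.lt_succ_self, if_true, mul_sum]
  congr 1
  exact sum_congr rfl fun r _ => by ring

/-- The correction accounts for truncated subtraction: a block consisting of holes only has weight
1, not m. -/
theorem inv_pow_pred (m x : ℕ) (hm : 1 ≤ m) :
    ((1 : ℝ) / m) ^ (x - 1) = m * (1 / m) ^ x - (m - 1) * (if x = 0 then 1 else 0) := by
  have : (m : ℝ) ≠ 0 := by positivity
  rcases x with _ | x
  · simp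
  · simp only [Nat.add_sub_cancel, pow_succ]
    field_simp
    simp

theorem choose_div_choose_succ (h n r : ℕ) (hr : r < n) :
    (h.choose (r + 1) : ℝ) / (n.choose (r + 1) : ℝ)
      = (h.choose r : ℝ) / (n.choose r : ℝ) * (((h - r : ℕ) : ℝ) / ((n : ℝ) - r)) := by
  have h1 : (h.choose (r + 1) : ℝ) * ((r + 1 : ℕ) : ℝ) = h.choose r * ((h - r : ℕ) : ℝ) := by
    exact_mod_cast Nat.choose_succ_right_eq h r
  have h2 : (n.choose (r + 1) : ℝ) * ((r + 1 : ℕ) : ℝ) = n.choose r * ((n : ℝ) - r) := by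
    rw [← Nat.cast_sub hr.le]; exact_mod_cast Nat.choose_succ_right_eq n r
  have p1 : ((r + 1 : ℕ) : ℝ) ≠ 0 := by positivity
  have p2 : (n.choose (r + 1) : ℝ) ≠ 0 := by exact_mod_cast (Nat.choose_pos hr).ne'
  have p3 : (n.choose r : ℝ) ≠ 0 := by exact_mod_cast (Nat.choose_pos hr.le).ne'
  have p4 : (n : ℝ) - r ≠ 0 := by
    have : (r : ℝ) < n := by exact_mod_cast hr
    linarith
  rw [← mul_div_mul_right _ _ p1, h1, h2]
  field_simp

/-- The factor n/(n-r) makes the induction close: consecutive left sides have ratio (h-r)/(n-1-r) ≤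
h/(n-1). -/
theorem choose_div_choose_le (h n r : ℕ) (hn2 : 1 < n) (hh : h < n) (hr : r < n) :
    (h.choose r : ℝ) / (n.choose r : ℝ) * (n / (n - r)) ≤ (h / (n - 1)) ^ r := by
  induction r with
  | zero =>
    have : (n : ℝ) ≠ 0 := by positivity
    simp [this]
  | succ r ih =>
    have ih := ih (by omega)
    rw [choose_div_choose_succ h n r (by omega), pow_succ]
    have hr' : (r : ℝ) + 1 < n := by exact_mod_cast hr
    have hh' : (h : ℝ) + 1 ≤ n := by exact_mod_cast hh
    have hn2' : (1 : ℝ) < n := by exact_mod_cast hn2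
    have e : (h.choose r : ℝ) / (n.choose r : ℝ) * (((h - r : ℕ) : ℝ) / ((n : ℝ) - r))
        * (n / (n - ((r + 1 : ℕ) : ℝ)))
        = ((h.choose r : ℝ) / (n.choose r : ℝ) * (n / (n - r)))
          * (((h - r : ℕ) : ℝ) / ((n : ℝ) - 1 - r)) := by
      have : (n : ℝ) - r ≠ 0 := by linarith
      have : (n : ℝ) - 1 - r ≠ 0 := by linarith
      have : (n : ℝ) - ((r + 1 : ℕ) : ℝ) ≠ 0 := by push_cast; linarith
      push_cast at this ⊢
      field_simp
      ring
    rw [e]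
    refine mul_le_mul ih ?_ (div_nonneg (by positivity) (by linarith))
      (pow_nonneg (div_nonneg (by positivity) (by linarith)) _)
    rw [div_le_div_iff₀ (by linarith) (by linarith)]
    rcases le_total h r with hhr | hhr
    · rw [Nat.sub_eq_zero_of_le hhr]
      have : (0 : ℝ) ≤ h := by positivity
      have : (0 : ℝ) ≤ (n : ℝ) - 1 - r := by linarith
      push_cast
      rw [zero_mul]; positivity
    · rw [Nat.cast_sub hhr]
      have : (0 : ℝ) ≤ r := by positivity
      nlinarith

section SingleBlock

open Finset

variable {α : Type*} [DecidableEq α]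

/-- Each position of `G` contributes (1 - 1/m)·[t ∈ H] + 1/m; expand the product. -/
theorem inv_pow_card_sdiff (m : ℕ) (G H : Finset α) :
    ((1 : ℝ) / m) ^ #(G \ H) = ∑ S ∈ G.powerset,
      ((1 - 1 / (m : ℝ)) ^ #S * (1 / (m : ℝ)) ^ (#G - #S)) * (if S ⊆ H then (1 : ℝ) else 0) := by
  have h1 : ((1 : ℝ) / m) ^ #(G \ H)
      = ∏ t ∈ G, ((if t ∈ H then 1 - 1 / (m : ℝ) else 0) + 1 / (m : ℝ)) := by
    have : ∀ t ∈ G, (if t ∈ H then 1 - 1 / (m : ℝ) else 0) + 1 / (m : ℝ)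
        = if t ∈ H then 1 else 1 / (m : ℝ) := by
      intro t _; split_ifs <;> ring
    rw [prod_congr rfl this, prod_ite, prod_const_one, one_mul, prod_const, sdiff_eq_filter]
  rw [h1, prod_add]
  refine sum_congr rfl fun S hS => ?_
  rw [prod_const, card_sdiff_of_subset (mem_powerset.1 hS)]
  split_ifs with hSH
  · rw [prod_congr rfl fun t ht => if_pos (hSH ht), prod_const]; ring
  · obtain ⟨t, ht, htH⟩ := not_subset.1 hSH
    rw [prod_eq_zero ht (if_neg htH)]; ring

variable [Fintype α]

theorem sum_subset_indicator (S : Finset α) (h : ℕ) :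
    ∑ H ∈ powersetCard h univ, (if S ⊆ H then (1 : ℝ) else 0)
      = ((Fintype.card α).choose h : ℝ) * ((h.choose #S : ℝ) / ((Fintype.card α).choose #S : ℝ)) := by
  have h1 := card_filter_subset_powersetCard S h
  have h2 : ((Fintype.card α).choose #S : ℝ) ≠ 0 := by
    exact_mod_cast (Nat.choose_pos (card_le_univ S)).ne'
  rw [sum_boole, ← mul_div_assoc, eq_div_iff h2]
  exact_mod_cast h1

/-- Expected value of the block weight, as a combination of the factorial moments. -/
theorem sum_block_weight (m : ℕ) (hm : 1 ≤ m) (G : Finset α) (h : ℕ) :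
    ∑ H ∈ powersetCard h univ, ((1 : ℝ) / m) ^ (#(G \ H) - 1)
      = ((Fintype.card α).choose h : ℝ) * ∑ r ∈ range (#G + 1),
          (((#G).choose r : ℝ) * (m * ((1 - 1 / (m : ℝ)) ^ r * (1 / (m : ℝ)) ^ (#G - r)))
            - if r = #G then (m : ℝ) - 1 else 0)
          * ((h.choose r : ℝ) / ((Fintype.card α).choose r : ℝ)) := by
  have e1 : ∀ H ∈ powersetCard h (univ : Finset α), ((1 : ℝ) / m) ^ (#(G \ H) - 1)
      = m * ∑ S ∈ G.powerset,
        ((1 - 1 / (m : ℝ)) ^ #S * (1 / (m : ℝ)) ^ (#G - #S)) * (if S ⊆ H then (1 : ℝ) else 0)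
        - (m - 1) * (if G ⊆ H then 1 else 0) := by
    intro H _
    rw [inv_pow_pred m _ hm, inv_pow_card_sdiff]
    simp only [card_eq_zero, sdiff_eq_empty_iff_subset]
  rw [sum_congr rfl e1, sum_sub_distrib, ← mul_sum, ← mul_sum, sum_comm, sum_subset_indicator]
  simp only [← mul_sum, sum_subset_indicator]
  rw [sum_powerset_apply_card (fun r => (1 - 1 / (m : ℝ)) ^ r * (1 / (m : ℝ)) ^ (#G - r)
    * (((Fintype.card α).choose h : ℝ) * ((h.choose r : ℝ) / ((Fintype.card α).choose r : ℝ))))]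
  simp only [sub_mul, sum_sub_distrib, ite_mul, zero_mul, sum_ite_eq', mem_range,
    Nat.lt_succ_self, if_true, mul_sub, mul_sum, nsmul_eq_mul]
  congr 1
  · exact sum_congr rfl fun r _ => by ring
  · ring

/-- The expected block weight for a fixed number of holes exceeds that for independent holes by at
most the factor `(n / (n - 1)) ^ (k - 1)`. -/
theorem sum_block_weight_le (m : ℕ) (hm : 1 ≤ m) (G : Finset α) (hG : 1 ≤ #G) (h : ℕ)
    (hn : 1 < Fintype.card α) (hh : h < Fintype.card α) :
    ∑ H ∈ powersetCard h univ, ((1 : ℝ) / m) ^ (#(G \ H) - 1)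
      ≤ ((Fintype.card α).choose h : ℝ) *
        (((Fintype.card α : ℝ) / ((Fintype.card α : ℝ) - 1)) ^ (#G - 1)
          * agreeProb m #G ((h : ℝ) / Fintype.card α)) := by
  rw [sum_block_weight m hm]
  refine mul_le_mul_of_nonneg_left ?_ (by positivity)
  have hGn : #G ≤ Fintype.card α := card_le_univ G
  generalize Fintype.card α = n at *
  generalize #G = k at *
  rw [agreeProb_eq_sum, mul_sum, ← sub_nonneg, ← sum_sub_distrib]
  have hm' : (1 : ℝ) ≤ m := by exact_mod_cast hm
  have hm0 : (m : ℝ) ≠ 0 := by positivity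
  have hθ : 0 ≤ 1 - 1 / (m : ℝ) := by
    rw [sub_nonneg, div_le_one (by linarith)]; exact hm'
  have hn' : (1 : ℝ) < n := by exact_mod_cast hn
  have hh' : (h : ℝ) < n := by exact_mod_cast hh
  set K : ℝ := (n : ℝ) / (n - 1) with hK
  have hK1 : 1 ≤ K := by rw [hK, one_le_div (by linarith)]; linarith
  set d : ℝ := (h : ℝ) / n with hd
  have hd0 : 0 ≤ d := by positivity
  have hd1 : d ≤ 1 := by rw [hd, div_le_one (by linarith)]; exact hh'.le
  have hdK : (h : ℝ) / (n - 1) = K * d := by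
    have : (n : ℝ) - 1 ≠ 0 := by linarith
    rw [hK, hd]; field_simp
  set b : ℕ → ℝ := fun r =>
    (k.choose r : ℝ) * (m * ((1 - 1 / (m : ℝ)) ^ r * (1 / (m : ℝ)) ^ (k - r)))
        - if r = k then (m : ℝ) - 1 else 0 with hb
  have hμ : ∀ r, r < n → (h.choose r : ℝ) / (n.choose r : ℝ) * (n / (n - r)) ≤ K ^ r * d ^ r := by
    intro r hr
    rw [← mul_pow, ← hdK]
    exact choose_div_choose_le h n r hn hh hr
  -- Only the last coefficient `b k` can be negative, and all coefficients sum to `agreeProb m k 1`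
  -- = 1, so every partial sum is nonnegative.
  have key := sum_mul_nonneg_of_partialSums_nonneg b
    (fun r => K ^ (k - 1) * d ^ r - (h.choose r : ℝ) / (n.choose r : ℝ)) k ?_ ?_ ?_
  · refine key.trans_eq (sum_congr rfl fun r _ => ?_)
    ring
  · intro r hr
    rcases hr.lt_or_eq with hr | rfl
    · refine sum_nonneg fun j hj => ?_
      have hj : j ≠ k := by have := mem_range.1 hj; omega
      simp only [hb, if_neg hj, sub_zero]
      positivity
    · have h1 : ∑ j ∈ range (r + 1), b j = agreeProb m r 1 := by
        rw [agreeProb_eq_sum]; simp [hb]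
      rw [h1, agreeProb]; simp
  · intro r hr
    have hrn : (r : ℝ) < n := by exact_mod_cast hr.trans_le hGn
    rw [choose_div_choose_succ h n r (by omega)]
    have e : ∀ r : ℕ, (r : ℝ) < n → (h.choose r : ℝ) / (n.choose r : ℝ)
        - (h.choose r : ℝ) / (n.choose r : ℝ) * (((h - r : ℕ) : ℝ) / ((n : ℝ) - r))
        ≤ ((h.choose r : ℝ) / (n.choose r : ℝ) * (n / (n - r))) * (1 - d) := by
      intro r hrn
      have hx : 0 ≤ (h.choose r : ℝ) / (n.choose r : ℝ) := by positivity
      have : 1 - ((h - r : ℕ) : ℝ) / ((n : ℝ) - r) ≤ (n / (n - r)) * (1 - d) := by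
        have e1 : (n / (n - r)) * (1 - d) = (n - h) / ((n : ℝ) - r) := by rw [hd]; field_simp
        have e2 : 1 - ((h - r : ℕ) : ℝ) / ((n : ℝ) - r)
          = ((n : ℝ) - r - ((h - r : ℕ) : ℝ)) / ((n : ℝ) - r) := by
          have : (n : ℝ) - r ≠ 0 := by linarith
          field_simp
        rw [e1, e2]
        refine div_le_div_of_nonneg_right ?_ (by linarith)
        have : (h : ℝ) ≤ ((h - r : ℕ) : ℝ) + r := by exact_mod_cast (by omega : h ≤ h - r + r)
        linarith
      nlinarith
    have h1 := e r hrn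
    have h2 := mul_le_mul_of_nonneg_right (hμ r (by omega)) (sub_nonneg.2 hd1)
    have h3 : K ^ r * d ^ r * (1 - d) ≤ K ^ (k - 1) * d ^ r * (1 - d) := by
      have := pow_le_pow_right₀ hK1 (show r ≤ k - 1 by omega)
      have : 0 ≤ 1 - d := sub_nonneg.2 hd1
      gcongr
    rw [pow_succ]
    linarith
  · obtain ⟨l, rfl⟩ : ∃ l, k = l + 1 := ⟨k - 1, by omega⟩
    simp only [Nat.add_sub_cancel]
    rw [choose_div_choose_succ h n l (by omega), sub_nonneg, pow_succ, ← mul_assoc]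
    have hln : (l : ℝ) < n := by exact_mod_cast (by omega : l < n)
    have e : (h.choose l : ℝ) / (n.choose l : ℝ) * (((h - l : ℕ) : ℝ) / ((n : ℝ) - l))
        = ((h.choose l : ℝ) / (n.choose l : ℝ) * (n / (n - l))) * (((h - l : ℕ) : ℝ) / n) := by
      have : (n : ℝ) - l ≠ 0 := by linarith
      field_simp
    rw [e]
    refine mul_le_mul (hμ l (by omega)) ?_ (by positivity) (by positivity)
    rw [hd]
    refine div_le_div_of_nonneg_right ?_ (by linarith)
    exact_mod_cast (by omega : h - l ≤ h)

end SingleBlock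

/-! ### Counting the fillings that are constant on blocks. -/

section Letters

open Finset

/-- Fillings of the positions by `m` letters that are constant on each of finitely many disjoint
sets `A i`. -/
theorem card_constant_on_le {α ι : Type*} [DecidableEq α] [Fintype α] [DecidableEq ι] (m : ℕ)
    (s : Finset ι) (A : ι → Finset α) (hA : (s : Set ι).PairwiseDisjoint A) (hm : 1 ≤ m) :
    (Nat.card {v : α → Fin m // ∀ i ∈ s, ∀ x ∈ A i, ∀ y ∈ A i, v x = v y} : ℝ)
      ≤ (m : ℝ) ^ Fintype.card α * ∏ i ∈ s, ((1 : ℝ) / m) ^ (#(A i) - 1) := by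
  classical
  -- `R i` is `A i` without one representative, which determines the values on `R i`.
  have hR : ∀ i, ∃ R, R ⊆ A i ∧ #R = #(A i) - 1 ∧ (∀ x ∈ R, ∃ y ∈ A i, y ∉ R) := by
    intro i
    rcases (A i).eq_empty_or_nonempty with h | ⟨y, hy⟩
    · exact ⟨∅, by simp, by simp [h], by simp⟩
    · exact ⟨(A i).erase y, erase_subset _ _, card_erase_of_mem hy,
        fun _ _ => ⟨y, hy, notMem_erase _ _⟩⟩
  choose R hRA hRc hRe using hR
  set D : Finset α := s.biUnion R with hD
  have hDc : #D = ∑ i ∈ s, (#(A i) - 1) := by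
    rw [hD, card_biUnion]
    · exact sum_congr rfl fun i _ => hRc i
    · intro i hi j hj hij
      exact disjoint_of_subset_left (hRA i) (disjoint_of_subset_right (hRA j) (hA hi hj hij))
  have hinj : Function.Injective
      (fun (v : {v : α → Fin m // ∀ i ∈ s, ∀ x ∈ A i, ∀ y ∈ A i, v x = v y}) =>
        fun x : (Dᶜ : Finset α) => v.1 x.1) := by
    intro v w hvw
    have hout : ∀ x, x ∉ D → v.1 x = w.1 x := fun x hx =>
      congrFun hvw ⟨x, mem_compl.2 hx⟩
    refine Subtype.ext (funext fun x => ?_)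
    by_cases hx : x ∈ D
    · obtain ⟨i, hi, hxi⟩ := mem_biUnion.1 hx
      obtain ⟨y, hy, hyR⟩ := hRe i x hxi
      rw [v.2 i hi x (hRA i hxi) y hy, w.2 i hi x (hRA i hxi) y hy]
      refine hout y fun hyD => ?_
      obtain ⟨j, hj, hyj⟩ := mem_biUnion.1 hyD
      by_cases hij : i = j
      · subst hij; exact hyR hyj
      · exact disjoint_left.1 (hA hi hj hij) hy (hRA j hyj)
    · exact hout x hx
  have hle := Nat.card_le_card_of_injective _ hinj
  rw [Nat.card_eq_fintype_card (α := (Dᶜ : Finset α) → Fin m), Fintype.card_fun, Fintype.card_fin, Fintype.card_coe, card_compl] at hle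
  have hm0 : (m : ℝ) ≠ 0 := by positivity
  calc _ ≤ ((m ^ (Fintype.card α - #D) : ℕ) : ℝ) := by exact_mod_cast hle
    _ = (m : ℝ) ^ Fintype.card α * (1 / m) ^ #D := by
        push_cast
        rw [pow_sub₀ _ hm0 (card_le_univ D), one_div, inv_pow]
    _ = _ := by rw [hDc, prod_pow_eq_pow_sum]

/-- Counting bound for pairs of a set of `h` holes and a filling for which every block
carries at most one letter. -/
theorem card_holes_constant_le {α ι : Type*} [DecidableEq α] [Fintype α] [DecidableEq ι] (m : ℕ)
    (hm : 1 ≤ m) (s : Finset ι) (G : ι → Finset α) (hG : (s : Set ι).PairwiseDisjoint G)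
    (hG1 : ∀ i ∈ s, 1 ≤ #(G i)) (h : ℕ) (hn : 1 < Fintype.card α) (hh : h < Fintype.card α) :
    (∑ H ∈ powersetCard h (univ : Finset α),
      (Nat.card {v : α → Fin m // ∀ i ∈ s, ∀ x ∈ G i \ H, ∀ y ∈ G i \ H, v x = v y} : ℝ))
      ≤ (m : ℝ) ^ Fintype.card α * (((Fintype.card α).choose h : ℝ) *
        ∏ i ∈ s, (((Fintype.card α : ℝ) / ((Fintype.card α : ℝ) - 1)) ^ (#(G i) - 1)
          * agreeProb m #(G i) ((h : ℝ) / Fintype.card α))) := by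
  have hm' : (1 : ℝ) ≤ m := by exact_mod_cast hm
  -- This presents the block weight as an increasing function of the number of holes in the block.
  have e : ∀ H i, #(G i) - #(H ∩ G i) = #(G i \ H) := by
    intro H i; rw [card_sdiff]
  have h1 := sum_powersetCard_prod_le s G hG h hh.le
    (fun i a => ((1 : ℝ) / m) ^ (#(G i) - a - 1)) ?_ ?_ _ fun i hi => by
      simp only [e]
      exact sum_block_weight_le m hm (G i) (hG1 i hi) h hn hh
  · refine le_trans ?_ (mul_le_mul_of_nonneg_left h1 (by positivity))
    rw [mul_sum]
    refine sum_le_sum fun H _ => ?_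
    simp only [e]
    exact card_constant_on_le m s (fun i => G i \ H)
      (fun i hi j hj hij => disjoint_of_subset_left sdiff_subset
        (disjoint_of_subset_right sdiff_subset (hG hi hj hij))) hm
  · intro i a b hab
    refine pow_le_pow_of_le_one (by positivity) ?_ (by omega)
    rw [div_le_one (by linarith)]; exact hm'
  · intro i a; positivity

end Letters

/-! ### Unavoidability of Zimin patterns and attainment of the Ramsey length. -/

theorem mem_zimin_bounds {i t : ℕ} (ht : t ∈ zimin i) : 1 ≤ t ∧ t ≤ i := by
  induction i with
  | zero => simp [zimin] at ht
  | succ i ih =>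
    simp only [zimin, List.mem_append, List.mem_singleton] at ht
    rcases ht with (ht | ht) | ht
    · have := ih ht; omega
    · omega
    · have := ih ht; omega

theorem flatMap_zimin_update {A : Type*} (h : ℕ → List A) (i : ℕ) (g : List A) :
    (zimin i).flatMap (Function.update h (i + 1) g) = (zimin i).flatMap h := by
  refine List.flatMap_congr fun t ht => ?_
  have := (mem_zimin_bounds ht).2
  rw [Function.update_of_ne (by omega)]

/-- Zimin patterns are unavoidable over a finite alphabet. -/
theorem zimin_unavoidable (A : Type*) [Fintype A] [Nonempty A] (i : ℕ) :
    ∃ N : ℕ, ∀ w : List A, N ≤ w.length →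
      ∃ h : ℕ → List A, (∀ x, h x ≠ []) ∧ (zimin i).flatMap h <:+: w := by
  classical
  induction i with
  | zero =>
    obtain ⟨a⟩ := ‹Nonempty A›
    exact ⟨0, fun w _ => ⟨fun _ => [a], by simp, by simp [zimin]⟩⟩
  | succ i ih =>
    obtain ⟨N, hN⟩ := ih
    set K := Fintype.card (List.Vector A N) with hK
    -- There is room for K + 1 windows of length N, two of which must coincide; the spare letter
    -- after each window keeps the gap between the two nonempty.
    refine ⟨(K + 1) * (N + 1), fun w hw => ?_⟩
    have hlen : ∀ c : Fin (K + 1), c.1 * (N + 1) + N < w.length := by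
      intro c
      have : (c.1 + 1) * (N + 1) ≤ (K + 1) * (N + 1) := Nat.mul_le_mul_right _ c.2
      have : (c.1 + 1) * (N + 1) = c.1 * (N + 1) + N + 1 := by ring
      omega
    let block : Fin (K + 1) → List.Vector A N := fun c =>
      ⟨(w.drop (c.1 * (N + 1))).take N, by
        have := hlen c
        rw [List.length_take, List.length_drop]; omega⟩
    obtain ⟨a, b, hab, hblock⟩ := Fintype.exists_ne_map_eq_of_card_lt block
      (by rw [Fintype.card_fin]; omega)
    wlog hlt : a.1 < b.1 generalizing a b
    · exact this b a hab.symm hblock.symm (by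
        have : a.1 ≠ b.1 := fun h => hab (Fin.ext h)
        omega)
    have hB : (w.drop (a.1 * (N + 1))).take N = (w.drop (b.1 * (N + 1))).take N :=
      congrArg Subtype.val hblock
    set B := (w.drop (a.1 * (N + 1))).take N with hBdef
    have hBl : B.length = N := (block a).2
    obtain ⟨h, hne, x, y, hxy⟩ := hN B hBl.ge
    have hpos : a.1 * (N + 1) + N < b.1 * (N + 1) := by
      have : (a.1 + 1) * (N + 1) ≤ b.1 * (N + 1) := Nat.mul_le_mul_right _ hlt
      have : (a.1 + 1) * (N + 1) = a.1 * (N + 1) + N + 1 := by ring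
      omega
    set g := (w.drop (a.1 * (N + 1) + N)).take (b.1 * (N + 1) - (a.1 * (N + 1) + N)) with hg
    have hgl : 0 < g.length := by
      have := hlen b
      rw [hg, List.length_take, List.length_drop]; omega
    have hwd : w = w.take (a.1 * (N + 1)) ++ (B ++ (g ++ (B ++ w.drop (b.1 * (N + 1) + N)))) := by
      have e1 : w.drop (b.1 * (N + 1)) = B ++ w.drop (b.1 * (N + 1) + N) := by
        rw [hB, ← List.drop_drop, List.take_append_drop]
      have e2 : w.drop (a.1 * (N + 1) + N) = g ++ w.drop (b.1 * (N + 1)) := by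
        conv_lhs => rw [← List.take_append_drop (b.1 * (N + 1) - (a.1 * (N + 1) + N))
          (w.drop (a.1 * (N + 1) + N))]
        rw [List.drop_drop, Nat.add_sub_cancel' hpos.le]
      have e3 : w.drop (a.1 * (N + 1)) = B ++ w.drop (a.1 * (N + 1) + N) := by
        rw [hBdef, ← List.drop_drop, List.take_append_drop]
      rw [← e1, ← e2, ← e3, List.take_append_drop]
    -- With B = x h(Z_i) y, the factor B g B contains h(Z_i) (y g x) h(Z_i).
    refine ⟨Function.update h (i + 1) (y ++ g ++ x), ?_, ?_⟩
    · intro t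
      by_cases ht : t = i + 1
      · subst ht
        rw [Function.update_self]
        intro h0
        have := congrArg List.length h0
        simp only [List.length_append, List.length_nil] at this
        omega
      · rw [Function.update_of_ne ht]; exact hne t
    · refine ⟨w.take (a.1 * (N + 1)) ++ x, y ++ w.drop (b.1 * (N + 1) + N), ?_⟩
      simp only [zimin, List.flatMap_append, flatMap_zimin_update, List.flatMap_singleton,
        Function.update_self]
      conv_rhs => rw [hwd, ← hxy]
      simp only [List.append_assoc]

theorem PartialWord.compatible_ofWord_fill {A : Type*} (a : A) (f : PartialWord A) :
    PartialWord.Compatible f (PartialWord.ofWord (f.map fun x => x.getD a)) := by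
  unfold PartialWord.Compatible PartialWord.ofWord
  rw [List.map_map, List.forall₂_map_right_iff, List.forall₂_same]
  rintro x - b c rfl h
  simpa using h

theorem PartialWord.encounters_of_fill {A : Type*} (a : A) (w : PartialWord A) {p : List ℕ}
    {h : ℕ → List A} (hne : ∀ x, h x ≠ []) (hw : p.flatMap h <:+: w.map fun x => x.getD a) :
    w.Encounters p := by
  obtain ⟨l, r, hlr⟩ := hw
  obtain ⟨w1, w3, rfl, hw1, hw3⟩ := List.map_eq_append_iff.1 hlr.symm
  obtain ⟨w0, w2, rfl, -, hw2⟩ := List.map_eq_append_iff.1 hw1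
  exact ⟨h, hne, w2, ⟨w0, w3, rfl⟩, hw2 ▸ PartialWord.compatible_ofWord_fill a w2⟩

/-- The set defining the partial Ramsey length of a Zimin pattern is nonempty. -/
theorem partialRamseyLength_zimin_mem (m i : ℕ) (hm : 1 ≤ m) (d : ℚ) (hd0 : 0 < d) (hd1 : d < 1) :
    0 < partialRamseyLength d m (zimin i) ∧
    (∃ w : PartialWord (Fin m), w.length = partialRamseyLength d m (zimin i)
      ∧ w.holeDensity = d) ∧
    ∀ w : PartialWord (Fin m), w.length = partialRamseyLength d m (zimin i) →
      w.holeDensity = d → w.Encounters (zimin i) := by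
  have : Nonempty (Fin m) := ⟨⟨0, hm⟩⟩
  have a : Fin m := ⟨0, hm⟩
  obtain ⟨N, hN⟩ := zimin_unavoidable (Fin m) i
  -- A multiple of the denominator of `d` makes the density attainable, and the factor N + 1 makes
  -- the length at least N.
  refine Nat.sInf_mem (s := {n : ℕ | 0 < n ∧
    (∃ w : PartialWord (Fin m), w.length = n ∧ w.holeDensity = d) ∧
    ∀ w : PartialWord (Fin m), w.length = n → w.holeDensity = d → w.Encounters (zimin i)})
    ⟨d.den * (N + 1), Nat.mul_pos d.den_pos N.succ_pos, ?_, ?_⟩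
  · have hnum : d.num.toNat ≤ d.den := by
      have h1 : d.num < d.den := Rat.num_lt_denom_iff.2 hd1
      omega
    have hcast : ((d.num.toNat : ℕ) : ℚ) = d.num := by
      have : ((d.num.toNat : ℕ) : ℤ) = d.num := Int.toNat_of_nonneg (Rat.num_pos.2 hd0).le
      exact_mod_cast congrArg (Int.cast : ℤ → ℚ) this
    refine ⟨List.replicate (d.num.toNat * (N + 1)) none
      ++ List.replicate (d.den * (N + 1) - d.num.toNat * (N + 1)) (some a), ?_, ?_⟩
    · have := Nat.mul_le_mul_right (N + 1) hnum
      simp; omega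
    · have hle := Nat.mul_le_mul_right (N + 1) hnum
      have hN0 : ((N : ℚ) + 1) ≠ 0 := by positivity
      have hden : (d.den : ℚ) ≠ 0 := by exact_mod_cast d.den_pos.ne'
      simp only [PartialWord.holeDensity, List.countP_append, List.countP_replicate,
        List.length_append, List.length_replicate, Nat.add_sub_cancel' hle]
      simp only [Option.isNone_none, Option.isNone_some, if_true, Bool.false_eq_true, if_false,
        add_zero]
      push_cast
      rw [hcast, mul_div_mul_right _ _ hN0]
      exact Rat.num_div_den d
  · intro w hw _
    obtain ⟨h, hne, hi⟩ := hN (w.map fun x => x.getD a) (by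
      rw [List.length_map, hw]; nlinarith [d.den_pos])
    exact PartialWord.encounters_of_fill a w hne hi

/-! ### Encounters as conditions on blocks of equally labelled positions. -/

/-- The image of a Zimin pattern under a morphism with values of lengths `l t`, as a list of labels:
`(t, c)` stands for the `c`-th letter of the value on `t`. -/
def ziminLabels (i : ℕ) (l : ℕ → ℕ) : List (ℕ × ℕ) :=
  (zimin i).flatMap fun t => (List.range (l t)).map (Prod.mk t)

theorem count_zimin {i t : ℕ} (h1 : 1 ≤ t) (ht : t ≤ i) : (zimin i).count t = 2 ^ (i - t) := by
  induction i with
  | zero => omega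
  | succ i ih =>
    simp only [zimin, List.count_append]
    rcases ht.lt_or_eq with h | rfl
    · rw [ih (by omega), List.count_singleton, show i + 1 - t = (i - t) + 1 by omega, pow_succ]
      simp only [beq_iff_eq]
      rw [if_neg (by omega)]; ring
    · have : (zimin i).count (i + 1) = 0 := by
        rw [List.count_eq_zero]
        intro h; have := (mem_zimin_bounds h).2; omega
      simp [this]

theorem count_ziminLabels {i t c : ℕ} (l : ℕ → ℕ) (h1 : 1 ≤ t) (ht : t ≤ i) (hc : c < l t) :
    (ziminLabels i l).count (t, c) = 2 ^ (i - t) := by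
  have aux : ∀ p : List ℕ,
      (p.flatMap fun t => (List.range (l t)).map (Prod.mk t)).count (t, c) = p.count t := by
    intro p
    induction p with
    | nil => simp
    | cons a p ih =>
      rw [List.flatMap_cons, List.count_append, ih, List.count_cons]
      by_cases ha : a = t
      · subst ha
        rw [List.count_map_of_injective _ _ (Prod.mk_right_injective a),
          List.count_eq_one_of_mem List.nodup_range (List.mem_range.2 hc)]
        simp [add_comm]
      · have : ((List.range (l a)).map (Prod.mk a)).count (t, c) = 0 := by
          rw [List.count_eq_zero]; simp [ha]
        rw [this]; simp [ha]
  rw [ziminLabels, aux, count_zimin h1 ht]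

open Finset in
theorem length_ziminLabels (i : ℕ) (l : ℕ → ℕ) :
    (ziminLabels i l).length = ∑ t ∈ range i, 2 ^ (i - (t + 1)) * l (t + 1) := by
  induction i with
  | zero => simp [ziminLabels, zimin]
  | succ i ih =>
    rw [sum_range_succ]
    have : ∀ t ∈ range i, 2 ^ (i + 1 - (t + 1)) * l (t + 1)
        = 2 * (2 ^ (i - (t + 1)) * l (t + 1)) := by
      intro t ht
      have := mem_range.1 ht
      rw [show i + 1 - (t + 1) = (i - (t + 1)) + 1 by omega, pow_succ]; ring
    rw [sum_congr rfl this, ← mul_sum, ← ih]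
    simp only [ziminLabels, zimin, List.flatMap_append, List.length_append, List.flatMap_singleton,
      List.length_map, List.length_range, Nat.sub_self, pow_zero]
    ring

/-- Each letter of the image is a function of its label, so equal labels force equal letters. -/
theorem map_some_flatMap_eq {A : Type*} (i : ℕ) (h : ℕ → List A) :
    ((zimin i).flatMap h).map some
      = (ziminLabels i fun t => (h t).length).map fun x => (h x.1)[x.2]? := by
  rw [ziminLabels, List.map_flatMap, List.map_flatMap]
  refine List.flatMap_congr fun t _ => ?_
  rw [List.map_map]
  refine List.ext_getElem (by simp) fun k h1 h2 => ?_
  simp only [List.length_map] at h1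
  simp [h1]

section Blocks

open Finset

/-- The positions that carry the label `x` when the list `L` of labels is placed at offset `p`. -/
def labelBlock (n p : ℕ) (L : List (ℕ × ℕ)) (x : ℕ × ℕ) : Finset (Fin n) :=
  {z | p ≤ z.1 ∧ L[z.1 - p]? = some x}

theorem mem_labelBlock {n p : ℕ} {L : List (ℕ × ℕ)} {x : ℕ × ℕ} {z : Fin n} :
    z ∈ labelBlock n p L x ↔ p ≤ z.1 ∧ L[z.1 - p]? = some x := by
  simp [labelBlock]

theorem card_filter_getElem? (L : List (ℕ × ℕ)) (x : ℕ × ℕ) :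
    #{k ∈ range L.length | L[k]? = some x} = L.count x := by
  induction L using List.reverseRecOn with
  | nil => simp
  | append_singleton L a ih =>
    have e : #{k ∈ range L.length | (L ++ [a])[k]? = some x} = L.count x := by
      rw [← ih]
      congr 1
      refine filter_congr fun k hk => ?_
      rw [List.getElem?_append_left (mem_range.1 hk)]
    rw [List.length_append, List.length_singleton, range_add_one, filter_insert, List.count_append,
      List.count_singleton]
    by_cases h : a = x
    · subst h
      simp [e]
    · simp [h, e]

theorem card_labelBlock {n p : ℕ} {L : List (ℕ × ℕ)} (x : ℕ × ℕ) (hL : p + L.length ≤ n) :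
    #(labelBlock n p L x) = L.count x := by
  rw [← card_filter_getElem?]
  refine card_bij (fun z _ => z.1 - p) ?_ ?_ ?_
  · intro z hz
    rw [mem_labelBlock] at hz
    obtain ⟨hk, -⟩ := List.getElem?_eq_some_iff.1 hz.2
    exact mem_filter.2 ⟨mem_range.2 hk, hz.2⟩
  · intro z hz z' hz' h
    rw [mem_labelBlock] at hz hz'
    exact Fin.ext (by omega)
  · intro k hk
    simp only [mem_filter, mem_range] at hk
    exact ⟨⟨p + k, by omega⟩, by simp [mem_labelBlock, hk.2], by simp⟩

theorem disjoint_labelBlock {n p : ℕ} {L : List (ℕ × ℕ)} {x y : ℕ × ℕ} (hxy : x ≠ y) :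
    Disjoint (labelBlock n p L x) (labelBlock n p L y) := by
  rw [disjoint_left]
  intro z hz hz'
  rw [mem_labelBlock] at hz hz'
  exact hxy (Option.some_injective _ (hz.2.symm.trans hz'.2))

/-- The word `v` with the positions in `H` turned into holes. -/
def punch {n m : ℕ} (H : Finset (Fin n)) (v : Fin n → Fin m) : PartialWord (Fin m) :=
  List.ofFn fun z => if z ∈ H then none else some (v z)

theorem holeDensity_punch {n m : ℕ} (H : Finset (Fin n)) (v : Fin n → Fin m) :
    (punch H v).holeDensity = (#H : ℚ) / n := by
  have : (punch H v).countP Option.isNone = #H := by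
    rw [punch, List.ofFn_eq_map, List.countP_map]
    have e : (Option.isNone ∘ fun z => if z ∈ H then none else some (v z))
        = fun z => decide (z ∈ H) := by
      funext z; by_cases hz : z ∈ H <;> simp [hz]
    rw [e, List.countP_eq_length_filter,
      ← List.toFinset_card_of_nodup ((List.nodup_finRange n).filter _)]
    congr 1
    ext z; simp
  rw [PartialWord.holeDensity, this]
  simp [punch]

theorem List.Forall₂.rel_of_getElem? {α β : Type*} {R : α → β → Prop} {u : List α} {v : List β}
    (h : List.Forall₂ R u v) {k : ℕ} {x : α} {y : β} (hx : u[k]? = some x) (hy : v[k]? = some y) :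
    R x y := by
  induction h generalizing k with
  | nil => simp at hx
  | cons hab _ ih =>
    cases k with
    | zero => simp at hx hy; subst hx hy; exact hab
    | succ k => exact ih (by simpa using hx) (by simpa using hy)

/-- An encounter with a Zimin pattern yields lengths and an offset for which equally labelled
letters agree. -/
theorem exists_labelBlock_constant {n m i : ℕ} {H : Finset (Fin n)} {v : Fin n → Fin m}
    (hw : (punch H v).Encounters (zimin i)) :
    ∃ l : ℕ → ℕ, (∀ t, 1 ≤ l t) ∧ ∃ p, p + (ziminLabels i l).length ≤ n ∧
      ∀ x, ∀ y ∈ labelBlock n p (ziminLabels i l) x \ H,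
        ∀ z ∈ labelBlock n p (ziminLabels i l) x \ H, v y = v z := by
  obtain ⟨h, hne, f, ⟨a, b, hab⟩, hf⟩ := hw
  rw [PartialWord.Compatible, PartialWord.ofWord, map_some_flatMap_eq] at hf
  have hlen := hf.length_eq
  rw [List.length_map] at hlen
  have hmap := map_some_flatMap_eq i h
  refine ⟨fun t => (h t).length, fun t => List.length_pos_iff.2 (hne t), a.length, ?_, ?_⟩
  · have := congrArg List.length hab
    simp only [punch, List.length_append, List.length_ofFn] at this
    omega
  · intro x
    have key : ∀ y ∈ labelBlock n a.length (ziminLabels i fun t => (h t).length) x \ H,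
        (h x.1)[x.2]? = some (v y) := by
      intro y hy
      rw [mem_sdiff, mem_labelBlock] at hy
      obtain ⟨⟨hay, hLy⟩, hyH⟩ := hy
      have hk := (List.getElem?_eq_some_iff.1 hLy).1
      have h1 : f[y.1 - a.length]? = some (some (v y)) := by
        have h2 : (a ++ f ++ b)[y.1]? = some (some (v y)) := by
          rw [hab, punch, List.getElem?_ofFn]
          simp [hyH]
        rwa [List.getElem?_append_left (by rw [List.length_append]; omega),
          List.getElem?_append_right hay] at h2
      have h2 : ((ziminLabels i fun t => (h t).length).map fun x => (h x.1)[x.2]?)[y.1 - a.length]?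
          = some ((h x.1)[x.2]?) := by
        rw [List.getElem?_map, hLy]; rfl
      have h3 : ∃ c, (h x.1)[x.2]? = some c := by
        rw [← hmap, List.getElem?_map] at h2
        obtain ⟨c, -, hc⟩ := Option.map_eq_some_iff.1 h2
        exact ⟨c, hc.symm⟩
      obtain ⟨c, hc⟩ := h3
      have := hf.rel_of_getElem? h1 h2 (v y) c rfl hc
      rw [hc, this]
    intro y hy z hz
    exact Option.some_injective _ ((key y hy).symm.trans (key z hz))

/-! ### The count for one placement. -/

/-- Lengths `l j` for the variables `j + 1` with `j < e`, and `r` for the variable `e + 1`. -/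
def extendLengths {e : ℕ} (l : Fin e → ℕ) (r : ℕ) (t : ℕ) : ℕ :=
  if h : t - 1 < e then l ⟨t - 1, h⟩ else r

theorem length_ziminLabels_extendLengths {e : ℕ} (l : Fin e → ℕ) (r : ℕ) :
    (ziminLabels (e + 1) (extendLengths l r)).length = ∑ j, 2 ^ (e - j.1) * l j + r := by
  rw [length_ziminLabels, sum_range_succ, ← Fin.sum_univ_eq_sum_range
    (fun t => 2 ^ (e + 1 - (t + 1)) * extendLengths l r (t + 1))]
  simp [extendLengths]

/-- Bernoulli's inequality for (1 - 1/n)^M, followed by n - M ≥ n - s + 1. -/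
theorem pow_div_sub_one_le (n M s : ℕ) (hM : M + 1 ≤ s) (hs : s ≤ n) (hn : 1 < n) :
    ((n : ℝ) / (n - 1)) ^ M ≤ n / ((n : ℝ) - s + 1) := by
  have hn' : (1 : ℝ) < n := by exact_mod_cast hn
  have hM' : (M : ℝ) + 1 ≤ s := by exact_mod_cast hM
  have hs' : (s : ℝ) ≤ n := by exact_mod_cast hs
  have hb := one_add_mul_le_pow (a := -(1 / (n : ℝ))) (by
    have : 1 / (n : ℝ) ≤ 1 := by rw [div_le_one (by linarith)]; exact hn'.le
    linarith) M
  have e1 : 1 + (M : ℝ) * -(1 / (n : ℝ)) = (n - M) / n := by field_simp; ring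
  have e2 : 1 + -(1 / (n : ℝ)) = ((n : ℝ) / (n - 1))⁻¹ := by
    rw [inv_div]; field_simp; ring
  rw [e1, e2, inv_pow] at hb
  have hpos : 0 < ((n : ℝ) / (n - 1)) ^ M := pow_pos (div_pos (by linarith) (by linarith)) _
  have h1 : ((n : ℝ) / (n - 1)) ^ M ≤ n / (n - M) := by
    rw [← inv_div ((n : ℝ) - M) n, le_inv_comm₀ hpos (div_pos (by linarith) (by linarith))]
    exact hb
  exact h1.trans (div_le_div_of_nonneg_left (by linarith) (by linarith) (by linarith))

theorem agreeProb_pos (m k : ℕ) (hm : 1 ≤ m) {d : ℝ} (hd0 : 0 < d) (hd1 : d < 1) :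
    0 < agreeProb m k d := by
  have hm' : (1 : ℝ) ≤ m := by exact_mod_cast hm
  have : d ^ k ≤ (d + (1 - d) / m) ^ k :=
    pow_le_pow_left₀ hd0.le (by
      have : 0 ≤ (1 - d) / m := div_nonneg (by linarith) (by linarith)
      linarith) k
  have : 0 < d ^ k := by positivity
  rw [agreeProb]
  nlinarith

/-- Counting bound for one choice of lengths and offset. -/
theorem card_labelBlock_constant_le {m n h e p r : ℕ} (hm : 1 ≤ m) (he : 1 ≤ e) (l : Fin e → ℕ)
    (hl : ∀ j, 1 ≤ l j) (hp : p + (∑ j, 2 ^ (e - j.1) * l j + r) ≤ n) (hh0 : 0 < h) (hh : h < n) :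
    (∑ H ∈ powersetCard h (univ : Finset (Fin n)),
      (Nat.card {v : Fin n → Fin m // ∀ x,
        ∀ y ∈ labelBlock n p (ziminLabels (e + 1) (extendLengths l r)) x \ H,
        ∀ z ∈ labelBlock n p (ziminLabels (e + 1) (extendLengths l r)) x \ H, v y = v z} : ℝ))
      ≤ (m : ℝ) ^ n * ((n.choose h : ℝ) *
        (n / ((n : ℝ) - (∑ j, 2 ^ (e - j.1) * l j : ℕ) + 1)
          * ∏ j : Fin e, agreeProb m (2 ^ (e - j.1)) ((h : ℝ) / n) ^ l j)) := by
  set L := ziminLabels (e + 1) (extendLengths l r) with hL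
  set s := ∑ j : Fin e, 2 ^ (e - j.1) * l j with hs
  have hlen : p + L.length ≤ n := by
    rw [hL, length_ziminLabels_extendLengths]; exact hp
  have hn : 1 < n := by omega
  have hd0 : (0 : ℝ) < (h : ℝ) / n := by
    have : (0 : ℝ) < h := by exact_mod_cast hh0
    have : (0 : ℝ) < n := by exact_mod_cast (by omega : 0 < n)
    positivity
  have hd1 : (h : ℝ) / n < 1 := by
    rw [div_lt_one (by exact_mod_cast (by omega : 0 < n))]; exact_mod_cast hh
  -- Labels of the last variable are omitted: their blocks are single positions.
  set S : Finset (Σ _ : Fin e, ℕ) := univ.sigma fun j => range (l j) with hS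
  set G : (Σ _ : Fin e, ℕ) → Finset (Fin n) := fun x => labelBlock n p L (x.1.1 + 1, x.2) with hG
  have hcard : ∀ x ∈ S, #(G x) = 2 ^ (e - x.1.1) := by
    rintro ⟨j, c⟩ hx
    simp only [hS, mem_sigma, mem_univ, true_and, mem_range] at hx
    rw [hG, card_labelBlock _ hlen, hL, count_ziminLabels _ (by omega) (by simp only; omega)]
    · simp
    · simp [extendLengths, hx]
  have main := card_holes_constant_le m hm S G ?_ ?_ h (by simpa using hn) (by simpa using hh)
  · rw [Fintype.card_fin] at main
    refine le_trans (sum_le_sum fun H _ => ?_) (main.trans ?_)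
    · rw [Nat.cast_le]
      exact Nat.card_le_card_of_injective
        (fun v => ⟨v.1, fun i _ => v.2 (i.1.1 + 1, i.2)⟩)
        fun v w hvw => Subtype.ext (congrArg (fun u => u.1) hvw)
    · refine mul_le_mul_of_nonneg_left (mul_le_mul_of_nonneg_left ?_ (by positivity))
        (by positivity)
      rw [prod_congr rfl fun x hx => by rw [hcard x hx], prod_mul_distrib,
        prod_pow_eq_pow_sum, hS, sum_sigma, prod_sigma]
      simp only [prod_const, card_range, sum_const, smul_eq_mul]
      refine mul_le_mul_of_nonneg_right ?_
        (prod_nonneg fun j _ => pow_nonneg (agreeProb_pos m _ hm hd0 hd1).le _)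
      refine pow_div_sub_one_le n _ s ?_ (by omega) hn
      -- The total exponent is s - ∑ l_j, hence at most s - 1 because some length is at least 1.
      have h1 : ∑ j : Fin e, l j * (2 ^ (e - j.1) - 1) + ∑ j : Fin e, l j = s := by
        rw [hs, ← sum_add_distrib]
        refine sum_congr rfl fun j _ => ?_
        have := Nat.one_le_two_pow (n := e - j.1)
        obtain ⟨q, hq⟩ := Nat.exists_eq_add_of_le this
        rw [hq, Nat.add_sub_cancel_left]; ring
      have h2 : l ⟨0, he⟩ ≤ ∑ j : Fin e, l j := single_le_sum (f := l) (fun _ _ => Nat.zero_le _)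
        (mem_univ _)
      have := hl ⟨0, he⟩
      omega
  · rintro ⟨j, c⟩ _ ⟨j', c'⟩ _ hne
    refine disjoint_labelBlock fun heq => hne ?_
    simp only [Prod.mk.injEq] at heq
    obtain ⟨h1, rfl⟩ := heq
    have : j = j' := Fin.ext (by omega)
    rw [this]
  · intro x hx
    rw [hcard x hx]; exact Nat.one_le_two_pow

end Blocks

/-! ### The first moment bound. -/

open Finset in
theorem two_mul_sum_range_sub_le (n N : ℕ) : 2 * ∑ q ∈ range n, (N - q) ≤ N * (N + 1) := by
  induction n generalizing N with
  | zero => simp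
  | succ n ih =>
    rw [sum_range_succ']
    rcases N with _ | N
    · simp
    · have := ih N
      simp only [Nat.add_sub_add_right, Nat.sub_zero]
      nlinarith

-- Here `x.2` is the offset and `x.1 + 1` the length of the last variable; for x.1 = q at most n - s
-- - q offsets remain.
open Finset in
theorem two_mul_card_placements_le (n s : ℕ) :
    2 * #{x ∈ range n ×ˢ range n | x.2 + (s + (x.1 + 1)) ≤ n} ≤ (n - s) * (n - s + 1) := by
  refine le_trans (Nat.mul_le_mul_left 2 ?_) (two_mul_sum_range_sub_le n (n - s))
  rw [card_filter, sum_product]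
  refine sum_le_sum fun q _ => ?_
  rw [← card_filter, ← card_range (n - s - q)]
  refine card_le_card fun p hp => ?_
  simp only [mem_filter, mem_range] at hp ⊢
  omega

/-- The value is 1 at k = 1, and passing from k to k + 1 lowers it by (m-1)(1-d)(q^k - d^k) with q =
d + (1-d)/m. -/
theorem agreeProb_lt_one (m k : ℕ) (hm : 2 ≤ m) (hk : 2 ≤ k) {d : ℝ} (hd0 : 0 < d)
    (hd1 : d < 1) : agreeProb m k d < 1 := by
  have hm' : (2 : ℝ) ≤ m := by exact_mod_cast hm
  have step : ∀ k, 1 ≤ k → agreeProb m (k + 1) d < agreeProb m k d := by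
    intro k hk
    have hq : d < d + (1 - d) / m := by
      have : 0 < (1 - d) / m := div_pos (by linarith) (by linarith)
      linarith
    have h1 := pow_lt_pow_left₀ hq hd0.le (show k ≠ 0 by omega)
    have e : agreeProb m k d - agreeProb m (k + 1) d
        = (m - 1) * (1 - d) * ((d + (1 - d) / m) ^ k - d ^ k) := by
      have : (m : ℝ) ≠ 0 := by positivity
      simp only [agreeProb, pow_succ]
      generalize (d + (1 - d) / m) ^ k = X
      field_simp
      ring
    have : 0 < agreeProb m k d - agreeProb m (k + 1) d := by
      rw [e]
      exact mul_pos (mul_pos (by linarith) (by linarith)) (by linarith)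
    linarith
  have one : agreeProb m 1 d = 1 := by
    have : (m : ℝ) ≠ 0 := by positivity
    simp only [agreeProb, pow_one]
    field_simp
    ring
  induction k, hk using Nat.le_induction with
  | base => simpa [one] using step 1 le_rfl
  | succ k hk ih => exact (step k (by omega)).trans ih

open Finset in
theorem sum_Icc_pow_le {x : ℝ} (h0 : 0 < x) (h1 : x < 1) (n : ℕ) :
    ∑ l ∈ Icc 1 n, x ^ l ≤ (1 / x - 1)⁻¹ := by
  have e : (1 / x - 1)⁻¹ = x / (1 - x) := by
    have : 1 - x ≠ 0 := by linarith
    field_simp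
  rw [e, le_div_iff₀ (by linarith)]
  have key : (∑ l ∈ Icc 1 n, x ^ l) * (1 - x) = x - x ^ (n + 1) := by
    induction n with
    | zero => simp
    | succ n ih => rw [sum_Icc_succ_top (by omega), add_mul, ih]; ring
  have : 0 < x ^ (n + 1) := by positivity
  linarith

open Finset in
/-- The first moment bound: if all words of length `n` with `h` holes encounter the Zimin pattern,
then `n` is large. -/
theorem two_mul_prod_le_sq {m n h e : ℕ} (hm : 2 ≤ m) (he : 1 ≤ e) (hh0 : 0 < h) (hh : h < n)
    (henc : ∀ (H : Finset (Fin n)) (v : Fin n → Fin m), #H = h →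
      (punch H v).Encounters (zimin (e + 1))) :
    2 * ∏ j : Fin e, (1 / agreeProb m (2 ^ (e - j.1)) ((h : ℝ) / n) - 1) ≤ (n : ℝ) ^ 2 := by
  classical
  have hn0 : (0 : ℝ) < n := by exact_mod_cast (by omega : 0 < n)
  have hh0' : (0 : ℝ) < h := by exact_mod_cast hh0
  set d : ℝ := (h : ℝ) / n with hd
  have hd0 : 0 < d := by positivity
  have hd1 : d < 1 := by rw [hd, div_lt_one hn0]; exact_mod_cast hh
  set P : Fin e → ℝ := fun j => agreeProb m (2 ^ (e - j.1)) d with hP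
  have hP0 : ∀ j, 0 < P j := fun j => agreeProb_pos m _ (by omega) hd0 hd1
  have hP1 : ∀ j, P j < 1 := fun j => agreeProb_lt_one m _ hm
    (by simpa using Nat.pow_le_pow_right (n := 2) (by norm_num) (show 1 ≤ e - j.1 by omega))
    hd0 hd1
  set s : (Fin e → ℕ) → ℕ := fun l => ∑ j, 2 ^ (e - j.1) * l j with hs
  set Λ : Finset (Fin e → ℕ) := Fintype.piFinset fun _ => Icc 1 n with hΛ
  set Q : (Fin e → ℕ) → Finset (ℕ × ℕ) := fun l =>
    {x ∈ range n ×ˢ range n | x.2 + (s l + (x.1 + 1)) ≤ n} with hQ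
  let bad : (Fin e → ℕ) → ℕ × ℕ → Finset (Fin n) → (Fin n → Fin m) → Prop := fun l x H v =>
    ∀ a, ∀ y ∈ labelBlock n x.2 (ziminLabels (e + 1) (extendLengths l (x.1 + 1))) a \ H,
      ∀ z ∈ labelBlock n x.2 (ziminLabels (e + 1) (extendLengths l (x.1 + 1))) a \ H, v y = v z
  have hcover : ∀ H ∈ powersetCard h (univ : Finset (Fin n)),
      (m : ℝ) ^ n ≤ ∑ l ∈ Λ, ∑ x ∈ Q l, (Nat.card {v // bad l x H v} : ℝ) := by
    -- Union bound over lengths and placements; no length exceeds n, so the range is finite.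
    intro H hH
    have hsub : (univ : Finset (Fin n → Fin m))
        ⊆ Λ.biUnion fun l => (Q l).biUnion fun x => {v | bad l x H v} := by
      intro v _
      obtain ⟨g, hg, p, hp, hbad⟩ := exists_labelBlock_constant (henc H v (mem_powersetCard.1 hH).2)
      set l : Fin e → ℕ := fun j => g (j.1 + 1) with hl
      have hext : ziminLabels (e + 1) g
          = ziminLabels (e + 1) (extendLengths l (g (e + 1) - 1 + 1)) := by
        refine List.flatMap_congr fun t ht => ?_
        have hb := mem_zimin_bounds ht
        have : extendLengths l (g (e + 1) - 1 + 1) t = g t := by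
          rw [extendLengths]
          split_ifs with h1
          · simp only [hl]; congr 1; omega
          · rw [Nat.sub_add_cancel (hg _)]; congr 1; omega
        rw [this]
      rw [hext] at hp hbad
      rw [length_ziminLabels_extendLengths] at hp
      have hls : ∀ j, l j ≤ s l := by
        intro j
        calc l j ≤ 2 ^ (e - j.1) * l j := Nat.le_mul_of_pos_left _ (by positivity)
          _ ≤ s l := single_le_sum (f := fun j : Fin e => 2 ^ (e - j.1) * l j)
            (fun _ _ => Nat.zero_le _) (mem_univ j)
      rw [mem_biUnion]
      refine ⟨l, ?_, ?_⟩
      · rw [hΛ, Fintype.mem_piFinset]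
        intro j
        have := hls j
        have := hg (j.1 + 1)
        rw [mem_Icc]
        exact ⟨this, by simp only [hs] at *; omega⟩
      · rw [mem_biUnion]
        refine ⟨(g (e + 1) - 1, p), ?_, ?_⟩
        · simp only [hQ, mem_filter, mem_product, mem_range, hs]
          omega
        · exact mem_filter.2 ⟨mem_univ _, hbad⟩
    have hc := card_le_card hsub
    rw [card_univ, Fintype.card_fun, Fintype.card_fin, Fintype.card_fin] at hc
    have hc2 : m ^ n ≤ ∑ l ∈ Λ, ∑ x ∈ Q l, Nat.card {v // bad l x H v} := by
      refine hc.trans (card_biUnion_le.trans (sum_le_sum fun l _ =>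
        card_biUnion_le.trans_eq (sum_congr rfl fun x _ => ?_)))
      rw [Nat.card_eq_fintype_card, Fintype.card_subtype]
    exact_mod_cast hc2
  have hone : ∀ l ∈ Λ, ∑ H ∈ powersetCard h (univ : Finset (Fin n)), ∑ x ∈ Q l,
      (Nat.card {v // bad l x H v} : ℝ)
      ≤ ((m : ℝ) ^ n * n.choose h) * ((n : ℝ) ^ 2 / 2 * ∏ j, P j ^ l j) := by
    intro l hl
    rw [hΛ, Fintype.mem_piFinset] at hl
    have hl1 : ∀ j, 1 ≤ l j := fun j => (mem_Icc.1 (hl j)).1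
    rw [sum_comm]
    have hprod0 : 0 ≤ ∏ j, P j ^ l j := prod_nonneg fun j _ => pow_nonneg (hP0 j).le _
    rcases (Q l).eq_empty_or_nonempty with h0 | ⟨x0, hx0⟩
    · rw [h0, sum_empty]; positivity
    · have hsn : s l ≤ n := by
        have := (mem_filter.1 hx0).2
        omega
      have hsn' : (s l : ℝ) ≤ n := by exact_mod_cast hsn
      have hb : ∀ x ∈ Q l, ∑ H ∈ powersetCard h (univ : Finset (Fin n)),
          (Nat.card {v // bad l x H v} : ℝ) ≤ (m : ℝ) ^ n * ((n.choose h : ℝ) *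
            (n / ((n : ℝ) - s l + 1) * ∏ j, P j ^ l j)) := fun x hx =>
        card_labelBlock_constant_le (by omega) he l hl1 (mem_filter.1 hx).2 hh0 hh
      refine (sum_le_sum hb).trans ?_
      rw [sum_const, nsmul_eq_mul]
      have hcard : 2 * (#(Q l) : ℝ) ≤ (n - s l) * (n - s l + 1) := by
        have := two_mul_card_placements_le n (s l)
        rw [← Nat.cast_sub hsn]
        exact_mod_cast this
      -- The factor n - s + 1 in the count of placements cancels the Bernoulli loss.
      have hfrac : (#(Q l) : ℝ) * (n / ((n : ℝ) - s l + 1)) ≤ (n : ℝ) ^ 2 / 2 := by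
        rw [← mul_div_assoc, div_le_iff₀ (by linarith)]
        have : (0 : ℝ) ≤ s l := by positivity
        nlinarith [mul_nonneg (mul_nonneg hn0.le this) (by linarith : 0 ≤ (n : ℝ) - s l + 1)]
      calc _ = ((m : ℝ) ^ n * n.choose h) * (((#(Q l) : ℝ) * (n / ((n : ℝ) - s l + 1)))
            * ∏ j, P j ^ l j) := by ring
        _ ≤ _ := mul_le_mul_of_nonneg_left (mul_le_mul_of_nonneg_right hfrac hprod0) (by positivity)
  have hsum : ∑ l ∈ Λ, ∏ j, P j ^ l j ≤ ∏ j, (1 / P j - 1)⁻¹ := by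
    rw [hΛ, sum_prod_piFinset (Icc 1 n) fun j k => P j ^ k]
    exact prod_le_prod (fun j _ => sum_nonneg fun k _ => pow_nonneg (hP0 j).le _)
      fun j _ => sum_Icc_pow_le (hP0 j) (hP1 j) n
  have hW : (0 : ℝ) < (m : ℝ) ^ n * n.choose h := by
    have : (0 : ℝ) < m := by exact_mod_cast (by omega : 0 < m)
    have : (0 : ℝ) < n.choose h := by exact_mod_cast Nat.choose_pos hh.le
    positivity
  have htot : (m : ℝ) ^ n * n.choose h
      ≤ ((m : ℝ) ^ n * n.choose h) * ((n : ℝ) ^ 2 / 2 * ∏ j, (1 / P j - 1)⁻¹) := by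
    calc (m : ℝ) ^ n * n.choose h
        = ∑ _H ∈ powersetCard h (univ : Finset (Fin n)), (m : ℝ) ^ n := by
          rw [sum_const, card_powersetCard, card_univ, Fintype.card_fin, nsmul_eq_mul, mul_comm]
      _ ≤ ∑ H ∈ powersetCard h (univ : Finset (Fin n)), ∑ l ∈ Λ, ∑ x ∈ Q l,
            (Nat.card {v // bad l x H v} : ℝ) := sum_le_sum hcover
      _ = ∑ l ∈ Λ, ∑ H ∈ powersetCard h (univ : Finset (Fin n)), ∑ x ∈ Q l,
            (Nat.card {v // bad l x H v} : ℝ) := sum_comm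
      _ ≤ ∑ l ∈ Λ, ((m : ℝ) ^ n * n.choose h) * ((n : ℝ) ^ 2 / 2 * ∏ j, P j ^ l j) :=
          sum_le_sum hone
      _ = ((m : ℝ) ^ n * n.choose h) * ((n : ℝ) ^ 2 / 2 * ∑ l ∈ Λ, ∏ j, P j ^ l j) := by
          rw [← mul_sum, ← mul_sum]
      _ ≤ _ := mul_le_mul_of_nonneg_left (mul_le_mul_of_nonneg_left hsum (by positivity)) hW.le
  have hfin : 1 ≤ (n : ℝ) ^ 2 / 2 * ∏ j, (1 / P j - 1)⁻¹ :=
    le_of_mul_le_mul_left (by linarith) hW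
  have hprod : 0 < ∏ j, (1 / P j - 1) := prod_pos fun j _ => by
    rw [sub_pos, lt_div_iff₀ (hP0 j), one_mul]; exact hP1 j
  rw [prod_inv_distrib, ← div_eq_mul_inv, le_div_iff₀ hprod] at hfin
  change 2 * ∏ j, (1 / P j - 1) ≤ _
  linarith

/-! ### Passage to the stated form. -/

theorem denominator_eq_agreeProb (m k : ℕ) (hm : 1 ≤ m) (hk : 1 ≤ k) (d : ℝ) :
    (1 + d * ((m : ℝ) - 1)) ^ k - (1 - 1 / (m : ℝ)) * ((m : ℝ) * d) ^ k
      = (m : ℝ) ^ (k - 1) * agreeProb m k d := by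
  have hm0 : (m : ℝ) ≠ 0 := by positivity
  obtain ⟨l, rfl⟩ : ∃ l, k = l + 1 := ⟨k - 1, by omega⟩
  have e : d + (1 - d) / m = (1 + d * ((m : ℝ) - 1)) / m := by field_simp; ring
  rw [agreeProb, e, div_pow, mul_pow, Nat.add_sub_cancel]
  generalize (1 + d * ((m : ℝ) - 1)) ^ (l + 1) = X
  rw [pow_succ (m : ℝ)]
  field_simp

open Finset in
/-- The partial Ramsey length of a Zimin pattern is at least the square root in question. -/
theorem sqrt_le_partialRamseyLength (m i : ℕ) (d : ℚ) (hm : 1 ≤ m) (hi : 1 ≤ i) (hd0 : 0 < d)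
    (hd1 : d < 1) :
    Real.sqrt (2 * ∏ j ∈ Icc 1 (i - 1),
        ((m : ℝ) ^ (2 ^ j - 1) /
          ((1 + (d : ℝ) * ((m : ℝ) - 1)) ^ (2 ^ j)
            - (1 - 1 / (m : ℝ)) * ((m : ℝ) * (d : ℝ)) ^ (2 ^ j)) - 1))
      ≤ (partialRamseyLength d m (zimin i) : ℝ) := by
  obtain ⟨hn0, ⟨w, hwl, hwd⟩, henc⟩ := partialRamseyLength_zimin_mem m i hm d hd0 hd1
  generalize partialRamseyLength d m (zimin i) = n at *
  have hm0 : (m : ℝ) ≠ 0 := by positivity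
  obtain ⟨h, hh⟩ : ∃ h : ℕ, (h : ℚ) / n = d := ⟨w.countP Option.isNone, by
    rw [← hwd, PartialWord.holeDensity, hwl]⟩
  have hn0' : (0 : ℚ) < n := by exact_mod_cast hn0
  have hh0 : 0 < h := by
    rcases Nat.eq_zero_or_pos h with rfl | h0
    · simp at hh; exact absurd hh.symm hd0.ne'
    · exact h0
  have hhn : h < n := by
    rw [← hh, div_lt_one hn0'] at hd1
    exact_mod_cast hd1
  have hdR : (d : ℝ) = (h : ℝ) / n := by rw [← hh]; push_cast; rfl
  have hterm : ∀ j ∈ Icc 1 (i - 1), (m : ℝ) ^ (2 ^ j - 1) /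
          ((1 + (d : ℝ) * ((m : ℝ) - 1)) ^ (2 ^ j)
            - (1 - 1 / (m : ℝ)) * ((m : ℝ) * (d : ℝ)) ^ (2 ^ j)) - 1
      = 1 / agreeProb m (2 ^ j) d - 1 := by
    intro j _
    rw [denominator_eq_agreeProb m _ hm Nat.one_le_two_pow,
      ← div_div, div_self (pow_ne_zero _ hm0)]
  rw [prod_congr rfl hterm]
  refine Real.sqrt_le_iff.2 ⟨by positivity, ?_⟩
  obtain ⟨e, rfl⟩ : ∃ e, i = e + 1 := ⟨i - 1, by omega⟩
  rw [Nat.add_sub_cancel]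
  -- For e = 0 the claim is √2 ≤ n, and 0 < h < n forces n ≥ 2.
  rcases Nat.eq_zero_or_pos e with rfl | he
  · have : (2 : ℝ) ≤ n := by exact_mod_cast (by omega : 2 ≤ n)
    simp only [zero_lt_one, Icc_eq_empty_of_lt, prod_empty]
    nlinarith
  -- Over one letter `agreeProb` is 1, so the product vanishes.
  rcases hm.eq_or_lt with rfl | hm2
  · rw [prod_eq_zero (mem_Icc.2 ⟨le_rfl, he⟩) (by simp [agreeProb])]
    simp only [mul_zero]; positivity
  · have key := two_mul_prod_le_sq (n := n) (h := h) hm2 he hh0 hhn fun H v hH =>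
      henc _ (by simp [punch]) (by rw [holeDensity_punch, hH, hh])
    rw [← hdR] at key
    convert key using 2
    -- The index reverses, since a_{j+1} occurs 2^(e-j) times.
    refine prod_bij' (fun j _ => (⟨e - j, by
      have := mem_Icc.1 ‹_›; omega⟩ : Fin e)) (fun j _ => e - j.1) ?_ ?_ ?_ ?_ ?_
    · intros; exact mem_univ _
    · intro j _; rw [mem_Icc]; omega
    · intro j hj; have := mem_Icc.1 hj; simp only; omega
    · intro j _; ext; simp only; omega
    · intro j hj
      have := mem_Icc.1 hj
      rw [show e - (e - j) = j by omega]

theorem mainTheorem12 :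
    ∃ δ : ℕ × ℕ × ℚ → ℝ,
      Filter.Tendsto δ
        (Filter.comap (fun t : ℕ × ℕ × ℚ => max t.1 t.2.1) Filter.atTop) (nhds 0) ∧
      ∀ (m i : ℕ) (d : ℚ), 1 ≤ m → 1 ≤ i → 0 < d → d < 1 →
        (1 + δ (m, i, d)) *
            Real.sqrt (2 * ∏ j ∈ Finset.Icc 1 (i - 1),
              ((m : ℝ) ^ (2 ^ j - 1) /
                ((1 + (d : ℝ) * ((m : ℝ) - 1)) ^ (2 ^ j)
                  - (1 - 1 / (m : ℝ)) * ((m : ℝ) * (d : ℝ)) ^ (2 ^ j)) - 1))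
          ≤ (partialRamseyLength d m (zimin i) : ℝ) := by
  refine ⟨fun _ => 0, tendsto_const_nhds, fun m i d hm hi hd0 hd1 => ?_⟩
  rw [add_zero, one_mul]
  exact sqrt_le_partialRamseyLength m i d hm hi hd0 hd1
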